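/- An order-preserving endomorphism $\varphi$ of $\mathbf N=\{0,1,2,\dots\}$ is of finite type when there are $n,m\in\mathbf N$ with $\varphi(n+k)=m+k$ for every $k\in\mathbf N$. Let $\mathcal O_\omega$ be the monoid, under composition $(\varphi\circ\psi)(x)=\varphi(\psi(x))$, of all order-preserving endomorphisms of $\mathbf N$ of finite type. For $i\in\mathbf N$ let $\sigma_i,\delta_i\in\mathcal O_\omega$ be given by $$\sigma_i(n)=\begin{cases}n & n\le i\\ n-1 & n>i,\end{cases}\qquad \delta_i(n)=\begin{cases}n & n<i\\ n+1 & n\ge i.\end{cases}$$ Let $\mathcal L_\omega$ be the monoid presented by generators $\lfloor k\rfloor$ (cups) and $\lceil k\rceil$ (caps), for all integers $k\ge 1$, and the relations, for all $1\le l\le k$, $$\lfloor k\rfloor\lfloor l\rfloor=\lfloor l\rfloor\lfloor k+2\rfloor,\quad \lceil l\rceil\lceil k\rceil=\lceil k+2\rceil\lceil l\rceil,\quad \lfloor l\rfloor\lceil k+2\rceil=\lceil k\rceil\lfloor l\rfloor,\quad \lfloor k+2\rfloor\lceil l\rceil=\lceil l\rceil\lfloor k\rfloor,$$ $$\lfloor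 k\rfloor\lceil k+1\rceil=\mathbf 1,\quad \lfloor k+1\rfloor\lceil k\rceil=\mathbf 1.$$ Let $\mathcal K_\omega$ have the same generators and relations together with $\lfloor k\rfloor\lceil k\rceil=\lfloor l\rfloor\lceil l\rceil$ for all $k,l\ge1$, and let $\mathcal J_\omega$ have the generators and relations of $\mathcal L_\omega$ together with $\lfloor k\rfloor\lceil k\rceil=\mathbf 1$ for all $k\ge 1$. Then: 1. $\mathcal O_\omega$ is presented, as a monoid, by the generators $\sigma_i,\delta_i$ ($i\in\mathbf N$) and the following relations for all $0\le i\le j$: $$\sigma_j\sigma_i=\sigma_i\sigma_{j+1},\quad \delta_i\delta_j=\delta_{j+1}\delta_i,\quad \sigma_i\delta_{j+2}=\delta_{j+1}\sigma_i,\quad \sigma_{j+1}\delta_i=\delta_i\sigma_j,\quad \sigma_i\delta_i=\sigma_i\delta_{i+1}=\mathbf 1.$$ 2. For each $\mathcal M\in\{\mathcal K_\omega,\mathcal L_\omega,\mathcal J_\omega\}$ there is an injective monoid homomorphism $\mathcal O_\omega\to\mathcal M$ with $\sigma_i\mapsto\lfloor 2i+2\rfloor$ and $\delta_i\mapsto\lceil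 2i+1\rceil$ for every $i\in\mathbf N$; in particular $\mathcal O_\omega$ is isomorphic to a submonoid of each of $\mathcal K_\omega$, $\mathcal L_\omega$, $\mathcal J_\omega$. -/

import Mathlib

namespace SimplicialOmega

/-- An order-preserving endomorphism `φ` of `ℕ` is of type `(n, m)` when
`φ (n + k) = m + k` for every `k`. -/
def IsOfType (φ : ℕ →o ℕ) (n m : ℕ) : Prop :=
  ∀ k : ℕ, φ (n + k) = m + k

/-- An order-preserving endomorphism of `ℕ` is of finite type when it has a type. -/
def IsOfFiniteType (φ : ℕ →o ℕ) : Prop :=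
  ∃ n m : ℕ, IsOfType φ n m

/-- The monoid `O_ω` of order-preserving endomorphisms of `ℕ` of finite type. The product of
the monoid `ℕ →o ℕ` is composition, `(φ * ψ) x = φ (ψ x)`, and its unit is the identity. -/
def OOmega : Submonoid (ℕ →o ℕ) where
  carrier := {φ | IsOfFiniteType φ}
  one_mem' := ⟨0, 0, fun _ => rfl⟩
  mul_mem' := by
    rintro φ ψ ⟨n, m, h⟩ ⟨n', m', h'⟩
    refine ⟨n' + n, m + m', fun k => ?_⟩
    have h1 : ψ (n' + n + k) = n + (m' + k) := by
      have := h' (n + k)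
      rw [add_assoc, this]; omega
    change φ (ψ (n' + n + k)) = m + m' + k
    rw [h1, h]; omega

/-- The endomorphism `σ_i`: `n ↦ n` for `n ≤ i`, and `n ↦ n - 1` for `n > i`. -/
def sigma (i : ℕ) : OOmega :=
  ⟨⟨fun n => if n ≤ i then n else n - 1, by
      intro a b h
      dsimp only
      split_ifs <;> omega⟩,
    ⟨i + 1, i, by
      intro k
      change (if i + 1 + k ≤ i then i + 1 + k else i + 1 + k - 1) = i + k
      split_ifs <;> omega⟩⟩

/-- The endomorphism `δ_i`: `n ↦ n` for `n < i`, and `n ↦ n + 1` for `n ≥ i`. -/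
def delta (i : ℕ) : OOmega :=
  ⟨⟨fun n => if n < i then n else n + 1, by
      intro a b h
      dsimp only
      split_ifs <;> omega⟩,
    ⟨i, i + 1, by
      intro k
      change (if i + k < i then i + k else i + k + 1) = i + 1 + k
      split_ifs <;> omega⟩⟩

/-- The generating symbols `σ_i`, `δ_i` for `i ∈ ℕ`. -/
inductive SimplicialGen : Type
  | sigma (i : ℕ) : SimplicialGen
  | delta (i : ℕ) : SimplicialGen

/-- `s i` is the one-letter word `σ_i`. -/
def s (i : ℕ) : FreeMonoid SimplicialGen := FreeMonoid.of (SimplicialGen.sigma i)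

/-- `d i` is the one-letter word `δ_i`. -/
def d (i : ℕ) : FreeMonoid SimplicialGen := FreeMonoid.of (SimplicialGen.delta i)

/-- The simplicial identities. -/
inductive SimplicialRel : FreeMonoid SimplicialGen → FreeMonoid SimplicialGen → Prop
  | sigma_sigma (i j : ℕ) (h : i ≤ j) : SimplicialRel (s j * s i) (s i * s (j + 1))
  | delta_delta (i j : ℕ) (h : i ≤ j) : SimplicialRel (d i * d j) (d (j + 1) * d i)
  | sigma_delta (i j : ℕ) (h : i ≤ j) : SimplicialRel (s i * d (j + 2)) (d (j + 1) * s i)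
  | sigma_delta' (i j : ℕ) (h : i ≤ j) : SimplicialRel (s (j + 1) * d i) (d i * s j)
  | sigma_delta_self (i : ℕ) : SimplicialRel (s i * d i) 1
  | sigma_delta_succ (i : ℕ) : SimplicialRel (s i * d (i + 1)) 1

/-- The generating symbols of `L_ω`, `K_ω` and `J_ω`: a cup and a cap for every positive
integer. -/
inductive CupCapGen : Type
  | cup (k : ℕ+) : CupCapGen
  | cap (k : ℕ+) : CupCapGen

/-- `u k` is the one-letter word consisting of the cup generator of index `k`. -/
def u (k : ℕ+) : FreeMonoid CupCapGen := FreeMonoid.of (CupCapGen.cup k)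

/-- `a k` is the one-letter word consisting of the cap generator of index `k`. -/
def a (k : ℕ+) : FreeMonoid CupCapGen := FreeMonoid.of (CupCapGen.cap k)

/-- The defining equations of `L_ω`. -/
inductive LRel : FreeMonoid CupCapGen → FreeMonoid CupCapGen → Prop
  | cup (l k : ℕ+) (h : l ≤ k) : LRel (u k * u l) (u l * u (k + 2))
  | cap (l k : ℕ+) (h : l ≤ k) : LRel (a l * a k) (a (k + 2) * a l)
  | cup_cap_one (l k : ℕ+) (h : l ≤ k) : LRel (u l * a (k + 2)) (a k * u l)
  | cup_cap_two (l k : ℕ+) (h : l ≤ k) : LRel (u (k + 2) * a l) (a l * u k)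
  | cup_cap_three_add (k : ℕ+) : LRel (u k * a (k + 1)) 1
  | cup_cap_three_sub (k : ℕ+) : LRel (u (k + 1) * a k) 1

/-- The defining equations of `K_ω`: those of `L_ω`, and all circles are equal. -/
inductive KRel : FreeMonoid CupCapGen → FreeMonoid CupCapGen → Prop
  | of_LRel {x y : FreeMonoid CupCapGen} (h : LRel x y) : KRel x y
  | circle (k l : ℕ+) : KRel (u k * a k) (u l * a l)

/-- The defining equations of `J_ω`: those of `L_ω`, and all circles are trivial. -/
inductive JRel : FreeMonoid CupCapGen → FreeMonoid CupCapGen → Prop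
  | of_LRel {x y : FreeMonoid CupCapGen} (h : LRel x y) : JRel x y
  | circle (k : ℕ+) : JRel (u k * a k) 1

/-- The monoid `L_ω`. -/
abbrev LOmega : Type := PresentedMonoid LRel

/-- The monoid `K_ω`. -/
abbrev KOmega : Type := PresentedMonoid KRel

/-- The monoid `J_ω`. -/
abbrev JOmega : Type := PresentedMonoid JRel

end SimplicialOmega

namespace SimplicialOmega

/-! ### The presentation of `O_ω` -/

/-! An endomorphism `φ` of finite type begins in one of three ways: if `φ 0 > 0` it factors as `δ_0
ψ`; if `φ 0 = φ 1 = 0`, as `ψ σ_0`; if `φ 0 = 0 < φ 1`, it is the shift of some `ψ`, that is, `ψ`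
with a fixed least point adjoined. Peeling off beginnings lowers the type, so the generators suffice
(`Simp.exists_ev_eq`). `Simp.IsNormal` imitates the peeling inside the presented monoid. The
relations make the normal elements stable under left multiplication by generators, so every element
is normal (`Simp.isNormal`). The beginning can be read off from the values at 0 and 1, whence
evaluation is injective (`Simp.eq_of_ev`).

The chosen cups and caps satisfy the simplicial identities, so for the embeddings only injectivity
is at stake. Let a cap insert an equal pair of arbitrary value into the sequences of a set, and let
a cup keep the sequences with an equal pair at its position and delete that pair. This action
satisfies the relations of `J_ω`, hence those of `K_ω` and `L_ω`. It moves the sets `pairedExcept n`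
exactly as `σ_i` and `δ_i` move `n`, so an endomorphism is recovered from its image. -/

theorem OOmega.ext_apply {φ ψ : OOmega} (h : ∀ n, φ.1 n = ψ.1 n) : φ = ψ :=
  Subtype.ext (OrderHom.ext _ _ (funext h))

theorem OOmega.mul_apply (φ ψ : OOmega) (n : ℕ) : (φ * ψ).1 n = φ.1 (ψ.1 n) := rfl

theorem OOmega.one_apply (n : ℕ) : (1 : OOmega).1 n = n := rfl

theorem sigma_apply (i n : ℕ) : (sigma i).1 n = if n ≤ i then n else n - 1 := rfl

theorem delta_apply (i n : ℕ) : (delta i).1 n = if n < i then n else n + 1 := rfl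

/-- The monoid presented by the simplicial identities. -/
abbrev Simp : Type := PresentedMonoid SimplicialRel

/-- The class of the generator `σ_i`. -/
def Simp.s (i : ℕ) : Simp := PresentedMonoid.of SimplicialRel (SimplicialGen.sigma i)

/-- The class of the generator `δ_i`. -/
def Simp.d (i : ℕ) : Simp := PresentedMonoid.of SimplicialRel (SimplicialGen.delta i)

namespace Simp

theorem s_mul_s {i j : ℕ} (h : i ≤ j) : s j * s i = s i * s (j + 1) :=
  PresentedMonoid.mk_eq_mk_of_rel (SimplicialRel.sigma_sigma i j h)

theorem d_mul_d {i j : ℕ} (h : i ≤ j) : d i * d j = d (j + 1) * d i :=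
  PresentedMonoid.mk_eq_mk_of_rel (SimplicialRel.delta_delta i j h)

theorem s_mul_d {i j : ℕ} (h : i ≤ j) : s i * d (j + 2) = d (j + 1) * s i :=
  PresentedMonoid.mk_eq_mk_of_rel (SimplicialRel.sigma_delta i j h)

theorem s_succ_mul_d {i j : ℕ} (h : i ≤ j) : s (j + 1) * d i = d i * s j :=
  PresentedMonoid.mk_eq_mk_of_rel (SimplicialRel.sigma_delta' i j h)

theorem s_mul_d_self (i : ℕ) : s i * d i = 1 :=
  PresentedMonoid.mk_eq_mk_of_rel (SimplicialRel.sigma_delta_self i)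

theorem s_mul_d_succ (i : ℕ) : s i * d (i + 1) = 1 :=
  PresentedMonoid.mk_eq_mk_of_rel (SimplicialRel.sigma_delta_succ i)

/-- A map on generators that satisfies the simplicial identities induces a homomorphism. -/
def liftOf {M : Type*} [Monoid M] (S D : ℕ → M)
    (ss : ∀ i j, i ≤ j → S j * S i = S i * S (j + 1))
    (dd : ∀ i j, i ≤ j → D i * D j = D (j + 1) * D i)
    (sd : ∀ i j, i ≤ j → S i * D (j + 2) = D (j + 1) * S i)
    (sd' : ∀ i j, i ≤ j → S (j + 1) * D i = D i * S j)
    (one : ∀ i, S i * D i = 1) (one' : ∀ i, S i * D (i + 1) = 1) : Simp →* M :=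
  PresentedMonoid.lift
    (fun g => match g with
      | SimplicialGen.sigma i => S i
      | SimplicialGen.delta i => D i)
    (by
      rintro _ _ (⟨i, j, h⟩ | ⟨i, j, h⟩ | ⟨i, j, h⟩ | ⟨i, j, h⟩ | i | i)
      · exact ss i j h
      · exact dd i j h
      · exact sd i j h
      · exact sd' i j h
      · exact one i
      · exact one' i)

@[elab_as_elim]
theorem induction_left {motive : Simp → Prop} (one : motive 1)
    (s_mul : ∀ i p, motive p → motive (s i * p))
    (d_mul : ∀ i p, motive p → motive (d i * p)) (p : Simp) : motive p := by
  obtain ⟨w, rfl⟩ := PresentedMonoid.surjective_mk p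
  induction w using FreeMonoid.inductionOn' with
  | one => exact one
  | of_mul g w ih =>
    cases g with
    | sigma i => exact s_mul i _ ih
    | delta i => exact d_mul i _ ih

/-- The canonical homomorphism onto `O_ω`. -/
def toOOmega : Simp →* OOmega :=
  liftOf sigma delta
    (fun i j h => OOmega.ext_apply fun n => by
      simp only [OOmega.mul_apply, sigma_apply]; split_ifs <;> omega)
    (fun i j h => OOmega.ext_apply fun n => by
      simp only [OOmega.mul_apply, delta_apply]; split_ifs <;> omega)
    (fun i j h => OOmega.ext_apply fun n => by
      simp only [OOmega.mul_apply, sigma_apply, delta_apply]; split_ifs <;> omega)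
    (fun i j h => OOmega.ext_apply fun n => by
      simp only [OOmega.mul_apply, sigma_apply, delta_apply]; split_ifs <;> omega)
    (fun i => OOmega.ext_apply fun n => by
      simp only [OOmega.mul_apply, OOmega.one_apply, sigma_apply, delta_apply]
      split_ifs <;> omega)
    (fun i => OOmega.ext_apply fun n => by
      simp only [OOmega.mul_apply, OOmega.one_apply, sigma_apply, delta_apply]
      split_ifs <;> omega)

/-- The endomorphism of `ℕ` represented by an element of the presented monoid. -/
def ev (p : Simp) (n : ℕ) : ℕ := (toOOmega p).1 n

theorem ev_one (n : ℕ) : ev 1 n = n := rfl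

theorem ev_mul (p q : Simp) (n : ℕ) : ev (p * q) n = ev p (ev q n) := by
  rw [ev, map_mul]; rfl

theorem ev_s (i n : ℕ) : ev (s i) n = if n ≤ i then n else n - 1 := rfl

theorem ev_d (i n : ℕ) : ev (d i) n = if n < i then n else n + 1 := rfl

/-- The shift endomorphism, which raises the index of every generator by one. -/
def shift : Simp →* Simp :=
  liftOf (fun i => s (i + 1)) (fun i => d (i + 1))
    (fun _ _ h => s_mul_s (Nat.succ_le_succ h))
    (fun _ _ h => d_mul_d (Nat.succ_le_succ h))
    (fun _ _ h => s_mul_d (Nat.succ_le_succ h))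
    (fun _ _ h => s_succ_mul_d (Nat.succ_le_succ h))
    (fun i => s_mul_d_self (i + 1)) (fun i => s_mul_d_succ (i + 1))

theorem shift_s (i : ℕ) : shift (s i) = s (i + 1) := rfl

theorem shift_d (i : ℕ) : shift (d i) = d (i + 1) := rfl

theorem ev_shift (p : Simp) : ev (shift p) 0 = 0 ∧ ∀ n, ev (shift p) (n + 1) = ev p n + 1 := by
  induction p using induction_left with
  | one => exact ⟨by rw [map_one, ev_one], fun n => by rw [map_one, ev_one, ev_one]⟩
  | s_mul i p ih =>
    refine ⟨?_, fun n => ?_⟩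
    · rw [map_mul, ev_mul, ih.1, shift_s, ev_s, if_pos (Nat.zero_le _)]
    · rw [map_mul, ev_mul, ih.2, shift_s, ev_s, ev_mul, ev_s]
      split_ifs <;> omega
  | d_mul i p ih =>
    refine ⟨?_, fun n => ?_⟩
    · rw [map_mul, ev_mul, ih.1, shift_d, ev_d, if_pos (Nat.succ_pos _)]
    · rw [map_mul, ev_mul, ih.2, shift_d, ev_d, ev_mul, ev_d]
      split_ifs <;> omega

/-- Every generator in a double shift has index at least 2, and `s 0` passes each of them, lowering
its index by one. -/
theorem s_zero_mul_shift_shift (p : Simp) : s 0 * shift (shift p) = shift p * s 0 := by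
  induction p using induction_left with
  | one => simp only [map_one, one_mul, mul_one]
  | s_mul i p ih =>
    rw [map_mul, map_mul, shift_s, shift_s, ← mul_assoc, ← s_mul_s (Nat.zero_le (i + 1)),
      mul_assoc, ih, mul_assoc]
  | d_mul i p ih =>
    rw [map_mul, map_mul, shift_d, shift_d, ← mul_assoc, s_mul_d (Nat.zero_le i),
      mul_assoc, ih, mul_assoc]

/-- The elements built up along the three possible beginnings of an endomorphism `φ`:
`φ 0 > 0`, or `φ 0 = φ 1 = 0`, or `φ 0 = 0 < φ 1`. -/
inductive IsNormal : Simp → Prop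
  | one : IsNormal 1
  | d_mul {p : Simp} (h : IsNormal p) : IsNormal (d 0 * p)
  | mul_s {p : Simp} (h : IsNormal p) (h0 : ev p 0 = 0) : IsNormal (p * s 0)
  | shift {p : Simp} (h : IsNormal p) : IsNormal (shift p)

/-! ### Every element of the presented monoid is normal. -/

theorem ev_d_zero_mul (p : Simp) (n : ℕ) : ev (d 0 * p) n = ev p n + 1 := by
  rw [ev_mul, ev_d, if_neg (Nat.not_lt_zero _)]

theorem ev_mul_s_zero_succ (p : Simp) (n : ℕ) : ev (p * s 0) (n + 1) = ev p n := by
  rw [ev_mul, ev_s, if_neg (by omega), Nat.add_sub_cancel]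

theorem ev_mul_s_zero_zero (p : Simp) : ev (p * s 0) 0 = ev p 0 := by
  rw [ev_mul, ev_s, if_pos le_rfl]

theorem isNormal_d (i : ℕ) : IsNormal (d i) := by
  induction i with
  | zero => simpa using IsNormal.one.d_mul
  | succ i ih => exact ih.shift

theorem isNormal_s (i : ℕ) : IsNormal (s i) := by
  induction i with
  | zero => simpa using IsNormal.one.mul_s rfl
  | succ i ih => exact ih.shift

theorem IsNormal.d_mul' {p : Simp} (h : IsNormal p) : ∀ i, IsNormal (d i * p) := by
  induction h with
  | one => intro i; rw [mul_one]; exact isNormal_d i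
  | @d_mul p h ih =>
    rintro (_ | i)
    · exact h.d_mul.d_mul
    · rw [← mul_assoc, ← d_mul_d (Nat.zero_le i), mul_assoc]
      exact (ih i).d_mul
  | @mul_s p h h0 ih =>
    rintro (_ | i)
    · exact (h.mul_s h0).d_mul
    · rw [← mul_assoc]
      exact (ih (i + 1)).mul_s (by rw [ev_mul, h0, ev_d, if_pos (Nat.succ_pos _)])
  | @shift p h ih =>
    rintro (_ | i)
    · exact h.shift.d_mul
    · rw [← shift_d, ← map_mul]
      exact (ih i).shift

/-- The hypothesis `h0` is essential: for `p = d 0` the left side is `s 0 * d 1 = 1`. It rules out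
an outermost `d 0`, and a factor `s 0` is absorbed by `s 0 * s 1 = s 0 * s 0`. -/
theorem IsNormal.s_zero_mul_shift {p : Simp} (h : IsNormal p) (h0 : ev p 0 = 0) :
    s 0 * Simp.shift p = p * s 0 := by
  induction h with
  | one => rw [map_one, one_mul, mul_one]
  | @d_mul p h ih => rw [ev_d_zero_mul] at h0; omega
  | @mul_s p h h0' ih =>
    rw [map_mul, ← mul_assoc, ih h0', shift_s, mul_assoc, mul_assoc, s_mul_s le_rfl]
  | @shift p h ih => exact s_zero_mul_shift_shift p

theorem IsNormal.s_mul {p : Simp} (h : IsNormal p) : ∀ i, IsNormal (s i * p) := by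
  induction h with
  | one => intro i; rw [mul_one]; exact isNormal_s i
  | @d_mul p h ih =>
    rintro (_ | i)
    · rwa [← mul_assoc, s_mul_d_self, one_mul]
    · rw [← mul_assoc, s_succ_mul_d (Nat.zero_le i), mul_assoc]
      exact (ih i).d_mul
  | @mul_s p h h0 ih =>
    intro i
    rw [← mul_assoc]
    exact (ih i).mul_s (by rw [ev_mul, h0, ev_s, if_pos (Nat.zero_le _)])
  | @shift p h ih =>
    rintro (_ | i)
    · rcases Nat.eq_zero_or_pos (ev p 0) with h0 | h0
      · rw [h.s_zero_mul_shift h0]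
        exact h.mul_s h0
      · cases h with
        | one => exact absurd h0 (lt_irrefl 0)
        | @d_mul p h =>
          rw [map_mul, ← mul_assoc, shift_d, s_mul_d_succ, one_mul]
          exact h.shift
        | @mul_s p h h0' => rw [ev_mul_s_zero_zero, h0'] at h0; omega
        | @shift p h => rw [(ev_shift p).1] at h0; omega
    · rw [← shift_s, ← map_mul]
      exact (ih i).shift

theorem isNormal (p : Simp) : IsNormal p := by
  induction p using induction_left with
  | one => exact .one
  | s_mul i p ih => exact ih.s_mul i
  | d_mul i p ih => exact ih.d_mul' i

/-! ### Evaluation is bijective. -/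

theorem eq_one_of_ev {p : Simp} (hp : ∀ n, ev p n = n) : p = 1 := by
  have h := isNormal p
  induction h with
  | one => rfl
  | @d_mul p h ih => have := hp 0; rw [ev_d_zero_mul] at this; omega
  | @mul_s p h h0 ih => have := hp 1; rw [ev_mul_s_zero_succ, h0] at this; omega
  | @shift p h ih =>
    rw [ih fun n => Nat.succ_injective (((ev_shift p).2 n).symm.trans (hp (n + 1))), map_one]

/-- The values at 0 and 1 force both elements to have the same outermost constructor, except that 1
is also a shift; `eq_one_of_ev` settles that overlap. -/
theorem eq_of_ev {p q : Simp} (hpq : ∀ n, ev p n = ev q n) : p = q := by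
  have h := isNormal p
  induction h generalizing q with
  | one => exact (eq_one_of_ev fun n => (hpq n).symm).symm
  | @d_mul p h ih =>
    have e0 := hpq 0
    rw [ev_d_zero_mul] at e0
    cases isNormal q with
    | one => rw [ev_one] at e0; omega
    | @d_mul q h' =>
      rw [ih (q := q) fun n => by have := hpq n; rw [ev_d_zero_mul, ev_d_zero_mul] at this; omega]
    | @mul_s q h' h0' => rw [ev_mul_s_zero_zero, h0'] at e0; omega
    | @shift q h' => rw [(ev_shift q).1] at e0; omega
  | @mul_s p h h0 ih =>
    have e0 := hpq 0
    have e1 := hpq 1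
    rw [ev_mul_s_zero_zero, h0] at e0
    rw [ev_mul_s_zero_succ, h0] at e1
    cases isNormal q with
    | one => rw [ev_one] at e1; omega
    | @d_mul q h' => rw [ev_d_zero_mul] at e0; omega
    | @mul_s q h' h0' =>
      rw [ih (q := q) fun n => by
        have := hpq (n + 1); rwa [ev_mul_s_zero_succ, ev_mul_s_zero_succ] at this]
    | @shift q h' => rw [(ev_shift q).2] at e1; omega
  | @shift p h ih =>
    have e0 := hpq 0
    have e1 := hpq 1
    rw [(ev_shift p).1] at e0
    rw [(ev_shift p).2] at e1
    cases isNormal q with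
    | one => exact eq_one_of_ev hpq
    | @d_mul q h' => rw [ev_d_zero_mul] at e0; omega
    | @mul_s q h' h0' => rw [ev_mul_s_zero_succ, h0'] at e1; omega
    | @shift q h' =>
      rw [ih (q := q) fun n => by
        have := hpq (n + 1); rw [(ev_shift p).2, (ev_shift q).2] at this; omega]

theorem toOOmega_injective : Function.Injective toOOmega :=
  fun _ _ h => eq_of_ev fun n => congrArg (fun φ : OOmega => φ.1 n) h

theorem exists_ev_eq (n m : ℕ) (φ : ℕ → ℕ) (hφ : Monotone φ) (h : ∀ k, φ (n + k) = m + k) :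
    ∃ p : Simp, ∀ x, ev p x = φ x := by
  induction hN : n + m using Nat.strong_induction_on generalizing n m φ with
  | _ N ih =>
    have hn := h 0
    rw [add_zero, add_zero] at hn
    rcases Nat.eq_zero_or_pos (φ 0) with h0 | h0
    · rcases n with _ | n
      -- Here `φ x = m + x` throughout, and `φ 0 = 0` gives `m = 0`.
      · refine ⟨1, fun x => ?_⟩
        have := h x
        rw [zero_add] at this
        rw [ev_one]
        omega
      · rcases Nat.eq_zero_or_pos (φ 1) with h1 | h1
        · obtain ⟨p, hp⟩ := ih (n + m) (by omega) n m (fun x => φ (x + 1))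
            (fun x y hxy => hφ (Nat.succ_le_succ hxy))
            (fun k => by rw [← h k]; congr 1; omega) rfl
          refine ⟨p * s 0, fun x => ?_⟩
          rcases x with _ | x
          · rw [ev_mul_s_zero_zero, hp, h0, h1]
          · rw [ev_mul_s_zero_succ, hp]
        · have hpos : ∀ x, 1 ≤ φ (x + 1) := fun x => h1.trans_le (hφ (by omega))
          have := hpos n
          obtain ⟨p, hp⟩ := ih (n + (m - 1)) (by omega) n (m - 1) (fun x => φ (x + 1) - 1)
            (fun x y hxy => Nat.sub_le_sub_right (hφ (Nat.succ_le_succ hxy)) 1)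
            (fun k => by
              have := h k
              rw [show n + 1 + k = n + k + 1 by omega] at this
              omega) rfl
          refine ⟨shift p, fun x => ?_⟩
          rcases x with _ | x
          · rw [(ev_shift p).1, h0]
          · rw [(ev_shift p).2, hp]
            have := hpos x
            omega
    · have hpos : ∀ x, 1 ≤ φ x := fun x => h0.trans_le (hφ (Nat.zero_le x))
      have := hpos n
      obtain ⟨p, hp⟩ := ih (n + (m - 1)) (by omega) n (m - 1) (fun x => φ x - 1)
        (fun x y hxy => Nat.sub_le_sub_right (hφ hxy) 1)
        (fun k => by
          have := h k
          omega) rfl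
      refine ⟨d 0 * p, fun x => ?_⟩
      rw [ev_d_zero_mul, hp]
      have := hpos x
      omega

theorem toOOmega_surjective : Function.Surjective toOOmega := by
  rintro ⟨φ, n, m, h⟩
  obtain ⟨p, hp⟩ := exists_ev_eq n m φ φ.monotone h
  exact ⟨p, OOmega.ext_apply hp⟩

/-- The simplicial identities present `O_ω`. -/
noncomputable def equivOOmega : Simp ≃* OOmega :=
  MulEquiv.ofBijective toOOmega ⟨toOOmega_injective, toOOmega_surjective⟩

end Simp

/-! ### An action of `J_ω` on sets of binary sequences -/

/-- Insert two copies of `b` into the sequence `x`, at the positions `k` and `k + 1`. -/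
def insertPair (k : ℕ) (b : Bool) (x : ℕ → Bool) : ℕ → Bool :=
  fun n => if n < k then x n else if n < k + 2 then b else x (n - 2)

/-- Delete the terms at the positions `k` and `k + 1` of the sequence `x`. -/
def deletePair (k : ℕ) (x : ℕ → Bool) : ℕ → Bool :=
  fun n => if n < k then x n else x (n + 2)

/-- The action of a cup. -/
def cupAct (k : ℕ) : Function.End (Set (ℕ → Bool)) :=
  fun S => {y | ∃ b, insertPair k b y ∈ S}

/-- The action of a cap. -/
def capAct (k : ℕ) : Function.End (Set (ℕ → Bool)) :=
  fun S => {x | x k = x (k + 1) ∧ deletePair k x ∈ S}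

/-! ### The action satisfies the relations of `J_ω`. -/

theorem cupAct_mul_cupAct {l k : ℕ} (h : l ≤ k) :
    cupAct k * cupAct l = cupAct l * cupAct (k + 2) := by
  funext S
  ext y
  have key : ∀ b c, insertPair l c (insertPair k b y) =
      insertPair (k + 2) b (insertPair l c y) := by
    intro b c
    funext n
    simp only [insertPair]
    split_ifs <;> first | rfl | omega
  change (∃ b c, insertPair l c (insertPair k b y) ∈ S) ↔
    ∃ c b, insertPair (k + 2) b (insertPair l c y) ∈ S
  simp only [key]
  exact exists_comm

theorem capAct_mul_capAct {l k : ℕ} (h : l ≤ k) :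
    capAct l * capAct k = capAct (k + 2) * capAct l := by
  funext S
  ext x
  have key : deletePair k (deletePair l x) = deletePair l (deletePair (k + 2) x) := by
    funext n
    simp only [deletePair]
    split_ifs <;> first | rfl | omega
  change (x l = x (l + 1) ∧ deletePair l x k = deletePair l x (k + 1) ∧
      deletePair k (deletePair l x) ∈ S) ↔
    (x (k + 2) = x (k + 2 + 1) ∧ deletePair (k + 2) x l = deletePair (k + 2) x (l + 1) ∧
      deletePair l (deletePair (k + 2) x) ∈ S)
  rw [key]
  simp only [deletePair, if_neg (show ¬ k < l by omega), if_neg (show ¬ k + 1 < l by omega),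
    if_pos (show l < k + 2 by omega), if_pos (show l + 1 < k + 2 by omega),
    show k + 1 + 2 = k + 2 + 1 by omega]
  tauto

theorem cupAct_mul_capAct {l k : ℕ} (h : l ≤ k) :
    cupAct l * capAct (k + 2) = capAct k * cupAct l := by
  funext S
  ext y
  have key : ∀ b, deletePair (k + 2) (insertPair l b y) = insertPair l b (deletePair k y) := by
    intro b
    funext n
    simp only [insertPair, deletePair]
    split_ifs <;> first | rfl | omega | (congr 1; omega)
  change (∃ b, insertPair l b y (k + 2) = insertPair l b y (k + 2 + 1) ∧
      deletePair (k + 2) (insertPair l b y) ∈ S) ↔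
    (y k = y (k + 1) ∧ ∃ b, insertPair l b (deletePair k y) ∈ S)
  simp only [key]
  simp only [insertPair, if_neg (show ¬ k + 2 < l by omega),
    if_neg (show ¬ k + 2 < l + 2 by omega), if_neg (show ¬ k + 2 + 1 < l by omega),
    if_neg (show ¬ k + 2 + 1 < l + 2 by omega), show k + 2 + 1 - 2 = k + 1 by omega,
    Nat.add_sub_cancel]
  exact exists_and_left

theorem cupAct_mul_capAct' {l k : ℕ} (h : l ≤ k) :
    cupAct (k + 2) * capAct l = capAct l * cupAct k := by
  funext S
  ext y
  have key : ∀ b, deletePair l (insertPair (k + 2) b y) = insertPair k b (deletePair l y) := by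
    intro b
    funext n
    simp only [insertPair, deletePair]
    split_ifs <;> first | rfl | omega | (congr 1; omega)
  change (∃ b, insertPair (k + 2) b y l = insertPair (k + 2) b y (l + 1) ∧
      deletePair l (insertPair (k + 2) b y) ∈ S) ↔
    (y l = y (l + 1) ∧ ∃ b, insertPair k b (deletePair l y) ∈ S)
  simp only [key]
  simp only [insertPair, if_pos (show l < k + 2 by omega), if_pos (show l + 1 < k + 2 by omega)]
  exact exists_and_left

theorem cupAct_mul_capAct_succ (k : ℕ) : cupAct k * capAct (k + 1) = 1 := by
  funext S
  ext y
  have key : deletePair (k + 1) (insertPair k (y k) y) = y := by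
    funext n
    simp only [insertPair, deletePair]
    split_ifs <;> first | rfl | omega | (congr 1; omega)
  have eq : ∀ b, (insertPair k b y (k + 1) = insertPair k b y (k + 1 + 1)) ↔ b = y k := by
    intro b
    simp [insertPair, show ¬ k + 1 + 1 < k by omega]
  change (∃ b, insertPair k b y (k + 1) = insertPair k b y (k + 1 + 1) ∧
      deletePair (k + 1) (insertPair k b y) ∈ S) ↔ y ∈ S
  simp only [eq, exists_eq_left, key]

theorem cupAct_succ_mul_capAct (k : ℕ) : cupAct (k + 1) * capAct k = 1 := by
  funext S
  ext y
  have key : deletePair k (insertPair (k + 1) (y k) y) = y := by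
    funext n
    simp only [insertPair, deletePair]
    split_ifs <;> first | rfl | omega | (congr 1; omega)
  have eq : ∀ b, (insertPair (k + 1) b y k = insertPair (k + 1) b y (k + 1)) ↔ b = y k := by
    intro b
    simp [insertPair, eq_comm]
  change (∃ b, insertPair (k + 1) b y k = insertPair (k + 1) b y (k + 1) ∧
      deletePair k (insertPair (k + 1) b y) ∈ S) ↔ y ∈ S
  simp only [eq, exists_eq_left, key]

/-- The inserted pair is the one deleted, so either value of `b` serves and the quantifier is
vacuous. -/
theorem cupAct_mul_capAct_self (k : ℕ) : cupAct k * capAct k = 1 := by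
  funext S
  ext y
  have key : ∀ b, deletePair k (insertPair k b y) = y := by
    intro b
    funext n
    simp only [insertPair, deletePair]
    split_ifs <;> first | rfl | omega
  have eq : ∀ b, insertPair k b y k = insertPair k b y (k + 1) := by
    intro b
    simp [insertPair]
  change (∃ b, insertPair k b y k = insertPair k b y (k + 1) ∧
      deletePair k (insertPair k b y) ∈ S) ↔ y ∈ S
  simp only [eq, key, true_and, exists_const]

/-- The action of a generator of `J_ω`. -/
def genAct : CupCapGen → Function.End (Set (ℕ → Bool))
  | .cup k => cupAct k
  | .cap k => capAct k

theorem lift_genAct_eq_of_LRel {x y : FreeMonoid CupCapGen} (h : LRel x y) :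
    FreeMonoid.lift genAct x = FreeMonoid.lift genAct y := by
  cases h with
  | cup l k h => exact cupAct_mul_cupAct (PNat.coe_le_coe _ _ |>.2 h)
  | cap l k h => exact capAct_mul_capAct (PNat.coe_le_coe _ _ |>.2 h)
  | cup_cap_one l k h => exact cupAct_mul_capAct (PNat.coe_le_coe _ _ |>.2 h)
  | cup_cap_two l k h => exact cupAct_mul_capAct' (PNat.coe_le_coe _ _ |>.2 h)
  | cup_cap_three_add k => exact cupAct_mul_capAct_succ k
  | cup_cap_three_sub k => exact cupAct_succ_mul_capAct k

theorem lift_genAct_eq_of_KRel {x y : FreeMonoid CupCapGen} (h : KRel x y) :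
    FreeMonoid.lift genAct x = FreeMonoid.lift genAct y := by
  cases h with
  | of_LRel h => exact lift_genAct_eq_of_LRel h
  | circle k l => exact (cupAct_mul_capAct_self k).trans (cupAct_mul_capAct_self l).symm

theorem lift_genAct_eq_of_JRel {x y : FreeMonoid CupCapGen} (h : JRel x y) :
    FreeMonoid.lift genAct x = FreeMonoid.lift genAct y := by
  cases h with
  | of_LRel h => exact lift_genAct_eq_of_LRel h
  | circle k => exact cupAct_mul_capAct_self k

/-- The sequences whose terms agree on every pair of positions `2 i + 1`, `2 i + 2`, except
possibly the pair with `i = n`. -/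
def pairedExcept (n : ℕ) : Set (ℕ → Bool) :=
  {x | ∀ i, i ≠ n → x (2 * i + 1) = x (2 * i + 2)}

theorem pairedExcept_injective : Function.Injective pairedExcept := by
  intro n m h
  by_contra hnm
  -- The sequence that is true only at `2 * n + 1` breaks the pair `n` and no other.
  have hx : (fun k => decide (k = 2 * n + 1)) ∈ pairedExcept n := by
    intro i hi
    rw [decide_eq_decide]
    omega
  rw [h] at hx
  have := hx n hnm
  rw [decide_eq_decide] at this
  omega

/-- The inserted pair straddles two blocks: block `i` becomes `(y (2 * i + 1), b)` and block `i + 1`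
becomes `(b, y (2 * i + 2))`. Together they say that block `i` of `y` is equal; if one of them is
exempt, `b` can be chosen to satisfy the other, so block `i` of `y` is exempt. -/
theorem cupAct_pairedExcept (i n : ℕ) :
    cupAct (2 * i + 2) (pairedExcept n) = pairedExcept ((sigma i).1 n) := by
  ext y
  have low : ∀ b j, j < i → insertPair (2 * i + 2) b y (2 * j + 1) = y (2 * j + 1) ∧
      insertPair (2 * i + 2) b y (2 * j + 2) = y (2 * j + 2) := by
    intro b j hj
    simp only [insertPair]
    rw [if_pos (by omega), if_pos (by omega)]
    exact ⟨rfl, rfl⟩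
  have mid : ∀ b, insertPair (2 * i + 2) b y (2 * i + 1) = y (2 * i + 1) ∧
      insertPair (2 * i + 2) b y (2 * i + 2) = b ∧
      insertPair (2 * i + 2) b y (2 * (i + 1) + 1) = b ∧
      insertPair (2 * i + 2) b y (2 * (i + 1) + 2) = y (2 * i + 2) := by
    intro b
    simp only [insertPair]
    rw [if_pos (by omega), if_neg (by omega), if_pos (by omega), if_neg (by omega),
      if_pos (by omega), if_neg (by omega), if_neg (by omega)]
    exact ⟨rfl, rfl, rfl, rfl⟩
  have high : ∀ b j, i < j → insertPair (2 * i + 2) b y (2 * (j + 1) + 1) = y (2 * j + 1) ∧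
      insertPair (2 * i + 2) b y (2 * (j + 1) + 2) = y (2 * j + 2) := by
    intro b j hj
    simp only [insertPair]
    rw [if_neg (by omega), if_neg (by omega), if_neg (by omega), if_neg (by omega)]
    exact ⟨rfl, rfl⟩
  rw [sigma_apply]
  constructor
  · rintro ⟨b, hb⟩ j hj
    rcases lt_trichotomy j i with hji | rfl | hji
    · have := hb j (by split_ifs at hj <;> omega)
      rwa [(low b j hji).1, (low b j hji).2] at this
    · have h1 := hb j (by split_ifs at hj <;> omega)
      have h2 := hb (j + 1) (by split_ifs at hj <;> omega)
      rw [(mid b).1, (mid b).2.1] at h1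
      rw [(mid b).2.2.1, (mid b).2.2.2] at h2
      exact h1.trans h2
    · have := hb (j + 1) (by split_ifs at hj <;> omega)
      rwa [(high b j hji).1, (high b j hji).2] at this
  · intro hy
    -- If block `i` is exempt, `b` must match the right neighbour; otherwise it must match the left
    -- one.
    refine ⟨if n = i then y (2 * i + 2) else y (2 * i + 1), fun j hj => ?_⟩
    rcases lt_trichotomy j i with hji | rfl | hji
    · rw [(low _ j hji).1, (low _ j hji).2]
      exact hy j (by split_ifs <;> omega)
    · rw [(mid _).1, (mid _).2.1, if_neg (Ne.symm hj)]
    · obtain ⟨j, rfl⟩ : ∃ j', j = j' + 1 := ⟨j - 1, by omega⟩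
      rcases Nat.eq_or_lt_of_le (Nat.le_of_lt_succ hji) with rfl | hji
      · rw [(mid _).2.2.1, (mid _).2.2.2]
        split_ifs with hn
        · rfl
        · exact hy i (by split_ifs <;> omega)
      · rw [(high _ j hji).1, (high _ j hji).2]
        exact hy j (by split_ifs <;> omega)

/-- The inserted pair is exactly block `i`, and it is never exempt; the blocks from `i` on move up
by one. -/
theorem capAct_pairedExcept (i n : ℕ) :
    capAct (2 * i + 1) (pairedExcept n) = pairedExcept ((delta i).1 n) := by
  ext x
  have low : ∀ j, j < i → deletePair (2 * i + 1) x (2 * j + 1) = x (2 * j + 1) ∧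
      deletePair (2 * i + 1) x (2 * j + 2) = x (2 * j + 2) := by
    intro j hj
    simp only [deletePair]
    rw [if_pos (by omega), if_pos (by omega)]
    exact ⟨rfl, rfl⟩
  have high : ∀ j, i ≤ j → deletePair (2 * i + 1) x (2 * j + 1) = x (2 * (j + 1) + 1) ∧
      deletePair (2 * i + 1) x (2 * j + 2) = x (2 * (j + 1) + 2) := by
    intro j hj
    simp only [deletePair]
    rw [if_neg (by omega), if_neg (by omega)]
    exact ⟨rfl, rfl⟩
  rw [delta_apply]
  constructor
  · rintro ⟨hi, hx⟩ j hj
    rcases lt_trichotomy j i with hji | rfl | hji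
    · have := hx j (by split_ifs at hj <;> omega)
      rwa [(low j hji).1, (low j hji).2] at this
    · exact hi
    · obtain ⟨j, rfl⟩ : ∃ j', j = j' + 1 := ⟨j - 1, by omega⟩
      have := hx j (by split_ifs at hj <;> omega)
      rwa [(high j (by omega)).1, (high j (by omega)).2] at this
  · intro hx
    refine ⟨hx i (by split_ifs <;> omega), fun j hj => ?_⟩
    rcases lt_or_ge j i with hji | hji
    · rw [(low j hji).1, (low j hji).2]
      exact hx j (by split_ifs <;> omega)
    · rw [(high j hji).1, (high j hji).2]
      exact hx (j + 1) (by split_ifs <;> omega)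

/-! ### Embeddings of `O_ω` -/

/-- A monoid presented by cups and caps receives an embedding of `O_ω` as soon as its relations
include those of `L_ω` and hold for the action on sets of binary sequences. -/
theorem exists_embedding {rel : FreeMonoid CupCapGen → FreeMonoid CupCapGen → Prop}
    (hL : ∀ x y, LRel x y → rel x y)
    (hact : ∀ x y, rel x y → FreeMonoid.lift genAct x = FreeMonoid.lift genAct y) :
    ∃ f : OOmega →* PresentedMonoid rel, Function.Injective f ∧
      (∀ i : ℕ, f (sigma i) =
        PresentedMonoid.of rel (CupCapGen.cup ((2 * i + 2).toPNat (Nat.succ_pos _)))) ∧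
      (∀ i : ℕ, f (delta i) =
        PresentedMonoid.of rel (CupCapGen.cap ((2 * i + 1).toPNat (Nat.succ_pos _)))) := by
  have le {m n : ℕ} (hm : 0 < m) (hn : 0 < n) (h : m ≤ n) : m.toPNat hm ≤ n.toPNat hn := h
  let g : Simp →* PresentedMonoid rel := Simp.liftOf
    (fun i => PresentedMonoid.of rel (CupCapGen.cup ((2 * i + 2).toPNat (Nat.succ_pos _))))
    (fun i => PresentedMonoid.of rel (CupCapGen.cap ((2 * i + 1).toPNat (Nat.succ_pos _))))
    (fun i j h => PresentedMonoid.mk_eq_mk_of_rel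
      (hL _ _ (LRel.cup _ _ (le (Nat.succ_pos _) (Nat.succ_pos _) (by omega)))))
    (fun i j h => PresentedMonoid.mk_eq_mk_of_rel
      (hL _ _ (LRel.cap _ _ (le (Nat.succ_pos _) (Nat.succ_pos _) (by omega)))))
    (fun i j h => PresentedMonoid.mk_eq_mk_of_rel
      -- With `k = 2 * (j + 1) + 1`, the index `k + 2` is that of the cap for `δ_{j+2}`.
      (hL _ _ (LRel.cup_cap_one ((2 * i + 2).toPNat (Nat.succ_pos _))
        ((2 * (j + 1) + 1).toPNat (Nat.succ_pos _))
        (le (Nat.succ_pos _) (Nat.succ_pos _) (by omega)))))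
    (fun i j h => PresentedMonoid.mk_eq_mk_of_rel
      (hL _ _ (LRel.cup_cap_two ((2 * i + 1).toPNat (Nat.succ_pos _))
        ((2 * j + 2).toPNat (Nat.succ_pos _))
        (le (Nat.succ_pos _) (Nat.succ_pos _) (by omega)))))
    (fun i => PresentedMonoid.mk_eq_mk_of_rel (hL _ _ (LRel.cup_cap_three_sub ((2 * i + 1).toPNat (Nat.succ_pos _)))))
    (fun i => PresentedMonoid.mk_eq_mk_of_rel (hL _ _ (LRel.cup_cap_three_add ((2 * i + 2).toPNat (Nat.succ_pos _)))))
  let act : PresentedMonoid rel →* Function.End (Set (ℕ → Bool)) :=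
    PresentedMonoid.lift genAct hact
  -- Acting on the family `pairedExcept` recovers the values of `p`, so `g` cannot identify elements
  -- with different evaluations.
  have hact_g : ∀ p : Simp, ∀ n, act (g p) (pairedExcept n) = pairedExcept (Simp.ev p n) := by
    intro p
    induction p using Simp.induction_left with
    | one => intro n; rw [map_one, map_one, Simp.ev_one]; rfl
    | s_mul i p ih =>
      intro n
      rw [map_mul, map_mul, Simp.ev_mul]
      change act (g (Simp.s i)) (act (g p) (pairedExcept n)) = _
      rw [ih]
      exact cupAct_pairedExcept i _
    | d_mul i p ih =>
      intro n
      rw [map_mul, map_mul, Simp.ev_mul]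
      change act (g (Simp.d i)) (act (g p) (pairedExcept n)) = _
      rw [ih]
      exact capAct_pairedExcept i _
  have hg : Function.Injective g := fun p q h => Simp.eq_of_ev fun n =>
    pairedExcept_injective (by rw [← hact_g, h, hact_g])
  refine ⟨g.comp Simp.equivOOmega.symm.toMonoidHom,
    hg.comp Simp.equivOOmega.symm.injective, fun i => ?_, fun i => ?_⟩
  · exact congrArg g (Simp.equivOOmega.symm_apply_apply (Simp.s i))
  · exact congrArg g (Simp.equivOOmega.symm_apply_apply (Simp.d i))

end SimplicialOmega

theorem mainTheorem7 :
    -- the simplicial identities present `O_ω` on the generators `σ_i`, `δ_i`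
    (∃ e : PresentedMonoid SimplicialOmega.SimplicialRel ≃* SimplicialOmega.OOmega,
      (∀ i : ℕ, e (PresentedMonoid.of SimplicialOmega.SimplicialRel
        (SimplicialOmega.SimplicialGen.sigma i)) = SimplicialOmega.sigma i) ∧
      (∀ i : ℕ, e (PresentedMonoid.of SimplicialOmega.SimplicialRel
        (SimplicialOmega.SimplicialGen.delta i)) = SimplicialOmega.delta i)) ∧
    -- `O_ω` embeds into `K_ω`
    (∃ f : SimplicialOmega.OOmega →* SimplicialOmega.KOmega, Function.Injective f ∧
      (∀ i : ℕ, f (SimplicialOmega.sigma i) =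
        PresentedMonoid.of SimplicialOmega.KRel
          (SimplicialOmega.CupCapGen.cup ((2 * i + 2).toPNat (Nat.succ_pos _)))) ∧
      (∀ i : ℕ, f (SimplicialOmega.delta i) =
        PresentedMonoid.of SimplicialOmega.KRel
          (SimplicialOmega.CupCapGen.cap ((2 * i + 1).toPNat (Nat.succ_pos _))))) ∧
    -- `O_ω` embeds into `L_ω`
    (∃ f : SimplicialOmega.OOmega →* SimplicialOmega.LOmega, Function.Injective f ∧
      (∀ i : ℕ, f (SimplicialOmega.sigma i) =
        PresentedMonoid.of SimplicialOmega.LRel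
          (SimplicialOmega.CupCapGen.cup ((2 * i + 2).toPNat (Nat.succ_pos _)))) ∧
      (∀ i : ℕ, f (SimplicialOmega.delta i) =
        PresentedMonoid.of SimplicialOmega.LRel
          (SimplicialOmega.CupCapGen.cap ((2 * i + 1).toPNat (Nat.succ_pos _))))) ∧
    -- `O_ω` embeds into `J_ω`
    (∃ f : SimplicialOmega.OOmega →* SimplicialOmega.JOmega, Function.Injective f ∧
      (∀ i : ℕ, f (SimplicialOmega.sigma i) =
        PresentedMonoid.of SimplicialOmega.JRel
          (SimplicialOmega.CupCapGen.cup ((2 * i + 2).toPNat (Nat.succ_pos _)))) ∧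
      (∀ i : ℕ, f (SimplicialOmega.delta i) =
        PresentedMonoid.of SimplicialOmega.JRel
          (SimplicialOmega.CupCapGen.cap ((2 * i + 1).toPNat (Nat.succ_pos _))))) := by
  exact ⟨⟨SimplicialOmega.Simp.equivOOmega, fun _ => rfl, fun _ => rfl⟩,
    SimplicialOmega.exists_embedding (fun _ _ => SimplicialOmega.KRel.of_LRel)
      fun _ _ => SimplicialOmega.lift_genAct_eq_of_KRel,
    SimplicialOmega.exists_embedding (fun _ _ => id)
      fun _ _ => SimplicialOmega.lift_genAct_eq_of_LRel,
    SimplicialOmega.exists_embedding (fun _ _ => SimplicialOmega.JRel.of_LRel)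
      fun _ _ => SimplicialOmega.lift_genAct_eq_of_JRel⟩
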